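/- For integers $m\ge 0$ let $$P_m(x)=\sum_{k=0}^{m}\frac{2m+1}{2k+1}\binom{m+k}{2k}x^{k},\qquad Q_m(x)=\sum_{k=0}^{m}\frac{m}{k}\binom{m+k-1}{2k-1}x^k,$$ where the $k=0$ term of $Q_m$ is read as $2$. All non-integer powers of real numbers and of $-1$ below are principal values. (a) Closed forms. Let $m\ge0$ and $x\in\mathbb{C}$. If $x\ne 2$, then $$P_m(x-2)=2^{-m-1}\left(\Big(1-\frac{\sqrt{x+2}}{\sqrt{x-2}}\Big)\big(x-\sqrt{x^2-4}\big)^m+\Big(1+\frac{\sqrt{x+2}}{\sqrt{x-2}}\Big)\big(x+\sqrt{x^2-4}\big)^m\right)$$ for every choice of the square roots $\sqrt{x+2}$ and $\sqrt{x-2}$, with $\sqrt{x^2-4}=\sqrt{x+2}\,\sqrt{x-2}$. For every $x\in\mathbb{C}$ and either choice of $\sqrt{x^2-4}$, $$Q_m(x-2)=2^{-m}\left(\big(x-\sqrt{x^2-4}\big)^m+\big(x+\sqrt{x^2-4}\big)^m\right).$$ (b) Iterated recurrences. For $0\le r\le\lfloor m/2\rfloor$ and $x\in\mathbb{C}$,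 $$P_m(x)=\sum_{j=0}^r(-1)^j\binom rj(x+2)^{r-j}P_{m-r-j}(x),\qquad Q_m(x)=\sum_{j=0}^r(-1)^j\binom rj(x+2)^{r-j}Q_{m-r-j}(x).$$ (c) Orthogonality. For every $k\ge 0$ and every complex polynomial $f$ of degree less than $k$, $$\int_{-4}^0x^{1/2}(4+x)^{-1/2}P_k(x)f(x)\,dx=0,\qquad \int_{-4}^0x^{-1/2}(4+x)^{-1/2}Q_k(x)f(x)\,dx=0,$$ and both integrals converge absolutely. (d) Mellin transforms. For every $n\ge0$ the integrals $$M_n^P(s)=\int_{-4}^0\frac{P_n(x)\,x^{s-3/4}}{(4+x)^{3/4}}\,dx\quad(\operatorname{Re}s>-\tfrac14),\qquad M_n^Q(s)=\int_{-4}^0\frac{Q_n(x)\,x^{s-5/4}}{(4+x)^{3/4}}\,dx\quad(\operatorname{Re}s>\tfrac14)$$ converge absolutely, and there are unique complex polynomials $p_n$, $q_n$ with $$M_n^P(s)=(-1)^{s+5/4}\,4^{s}\,4^{-n-1}\,\Gamma(\tfrac14)\,p_n(s)\,\frac{\Gamma(s+\frac14)}{\Gamma(s+\frac{2n+1}{2})}\quad(\operatorname{Re}s>-\tfrac14),$$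 $$M_n^Q(s)=(-1)^{s+3/4}\,4^{s-1}\,\Gamma(\tfrac54)\,q_n(s)\,\frac{\Gamma(s-\frac14)}{\Gamma(s+n)}\quad(\operatorname{Re}s>\tfrac14).$$ For each $n$ there are signs, independent of $s$, such that $p_n(s)=\pm p_n(1-s)$ and $q_n(s)=\pm q_n(1-s)$ for all $s\in\mathbb{C}$, and all zeros of $p_n$ and of $q_n$ lie on the critical line $\operatorname{Re}s=1/2$. -/

import Mathlib

open Polynomial

noncomputable section

/-- `P_m(x) = ∑_{k=0}^m (2m+1)/(2k+1) * binom(m+k, 2k) x^k`. -/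
def genP (m : ℕ) : ℂ[X] :=
  ∑ k ∈ Finset.range (m + 1),
    C (((2 * m + 1 : ℂ) / (2 * k + 1)) * ((m + k).choose (2 * k) : ℂ)) * X ^ k

/-- `Q_m(x) = ∑_{k=0}^m (m/k) * binom(m+k-1, 2k-1) x^k`, where the term with `k = 0`
is read as its limit value `2`. -/
def genQ (m : ℕ) : ℂ[X] :=
  C 2 + ∑ k ∈ Finset.Icc 1 m,
    C (((m : ℂ) / k) * ((m + k - 1).choose (2 * k - 1) : ℂ)) * X ^ k

/-- The integrand `P_m(x) x^(s-3/4) / (4+x)^(3/4)`, with principal powers. -/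
def mellinIntegrandP (m : ℕ) (s : ℂ) (x : ℝ) : ℂ :=
  (genP m).eval (x : ℂ) * (x : ℂ) ^ (s - 3 / 4) / ((4 + x : ℝ) : ℂ) ^ (3 / 4 : ℂ)

/-- The integrand `Q_m(x) x^(s-5/4) / (4+x)^(3/4)`, with principal powers. -/
def mellinIntegrandQ (m : ℕ) (s : ℂ) (x : ℝ) : ℂ :=
  (genQ m).eval (x : ℂ) * (x : ℂ) ^ (s - 5 / 4) / ((4 + x : ℝ) : ℂ) ^ (3 / 4 : ℂ)

/-- The Mellin transform `M_m^P(s)`; the integral converges for `Re s > -1/4`. -/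
def mellinP (m : ℕ) (s : ℂ) : ℂ := ∫ x in (-4 : ℝ)..0, mellinIntegrandP m s x

/-- The Mellin transform `M_m^Q(s)`; the integral converges for `Re s > 1/4`. -/
def mellinQ (m : ℕ) (s : ℂ) : ℂ := ∫ x in (-4 : ℝ)..0, mellinIntegrandQ m s x

/-- `p` is the polynomial factor of `M_m^P`. -/
def IsMellinFactorP (m : ℕ) (p : ℂ[X]) : Prop :=
  ∀ s : ℂ, -1 / 4 < s.re →
    mellinP m s = (-1 : ℂ) ^ (s + 5 / 4) * (4 : ℂ) ^ s * (4 : ℂ) ^ (-(m : ℂ) - 1) *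
      Complex.Gamma (1 / 4) * p.eval s *
      (Complex.Gamma (s + 1 / 4) / Complex.Gamma (s + (2 * m + 1) / 2))

/-- `q` is the polynomial factor of `M_m^Q`. -/
def IsMellinFactorQ (m : ℕ) (q : ℂ[X]) : Prop :=
  ∀ s : ℂ, 1 / 4 < s.re →
    mellinQ m s = (-1 : ℂ) ^ (s + 3 / 4) * (4 : ℂ) ^ (s - 1) *
      Complex.Gamma (5 / 4) * q.eval s *
      (Complex.Gamma (s - 1 / 4) / Complex.Gamma (s + m))

/-- `p(s) = ± p(1-s)` (one sign for all `s`), and all zeros of `p` lie on `Re s = 1/2`. -/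
def HasCriticalSymmetry (p : ℂ[X]) : Prop :=
  ((∀ s : ℂ, p.eval s = p.eval (1 - s)) ∨ (∀ s : ℂ, p.eval s = -p.eval (1 - s))) ∧
    ∀ s : ℂ, p.eval s = 0 → s.re = 1 / 2

/-- The integrand `x^(1/2) (4+x)^(-1/2) P_k(x) f(x)`. -/
def orthoIntegrandP (k : ℕ) (f : ℂ[X]) (x : ℝ) : ℂ :=
  (x : ℂ) ^ (1 / 2 : ℂ) * ((4 + x : ℝ) : ℂ) ^ (-1 / 2 : ℂ) *
    (genP k).eval (x : ℂ) * f.eval (x : ℂ)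

/-- The integrand `x^(-1/2) (4+x)^(-1/2) Q_k(x) f(x)`. -/
def orthoIntegrandQ (k : ℕ) (f : ℂ[X]) (x : ℝ) : ℂ :=
  (x : ℂ) ^ (-1 / 2 : ℂ) * ((4 + x : ℝ) : ℂ) ^ (-1 / 2 : ℂ) *
    (genQ k).eval (x : ℂ) * f.eval (x : ℂ)

end

/-!
With `x + 2 = 2 cos θ`, the polynomials are `P_m(x) = sin ((m + 1/2) θ) / sin (θ / 2)` and
`Q_m(x) = 2 cos (m θ)`. So both families satisfy the Chebyshev recurrence
`c_{n+2} = (x + 2) c_{n+1} - c_n` (`genP_recurrence`, `genQ_recurrence`), which is read off from the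
coefficients by Pascal's rule. The closed forms and the iterated recurrences are consequences of it.

All the integrals are values of the linear functional
`L p = ∫₀¹ p(-4t) t^(a-1) (1-t)^(b-1) dt` (`betaFunctional`), up to an explicit factor
(`integral_eval_mul_betaIntegrand`). The polynomials satisfy a first-order derivative identity
(`derivative_of_recurrence`); inserting it into integration by parts for the beta weight
(`betaFunctional_by_parts`) gives a three-term recurrence in `n` for `L c_n` with `a` and `b` fixed
(`betaFunctional_recurrence`):

`(a + b + n + 1) L c_{n+2} = 2 (b - a + ε) L c_{n+1} + (n + 1 + 2ε - a - b) L c_n`,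

with `ε = 1/2` for `P` and `ε = 0` for `Q`.

For the weights of the orthogonality relations it shows `L c_n = 0` for `n ≥ 1`, and multiplying
by `x` moves the index by at most one, which gives orthogonality to all lower degrees.

For the weights of the Mellin transforms, put `σ = s - 1/2`. Multiplying by `Γ(a + b + n)` turns the
recurrence into `A_{n+2} = -2σ A_{n+1} + ((n + δ)² - σ²) A_n` with `A_0 = 1`, `A_1 = -σ`, where
`δ = 1` for `P` and `δ = 1/2` for `Q`. These `A_n` (`critPoly`) are the required polynomials up to
constants. They satisfy `A_n(1 - s) = (-1)^n A_n(s)`. If `-A_{n+1} / A_n = g_n + σ`, then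
`g_{n+1} = (σ g_n + (n + δ)²) / (g_n + σ)`, a Möbius map which preserves `Re g ≥ 0` when `Re σ > 0`
(`re_mobius_nonneg`). Starting from `g_0 = 0`, no `A_n` vanishes for `Re s > 1/2`, hence by symmetry
none vanishes off the critical line.
-/

/-! ### The Chebyshev recurrence -/

lemma choose_second_difference (n j : ℕ) :
    ((n + 2).choose (j + 2) : ℂ) = 2 * (n + 1).choose (j + 2) - n.choose (j + 2) + n.choose j := by
  have h1 := Nat.choose_succ_succ (n + 1) (j + 1)
  have h2 := Nat.choose_succ_succ n (j + 1)
  have h3 := Nat.choose_succ_succ n j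
  have h : (n + 2).choose (j + 2) + n.choose (j + 2) = 2 * (n + 1).choose (j + 2) + n.choose j := by
    simp only [Nat.succ_eq_add_one, add_assoc, Nat.reduceAdd] at h1 h2 h3
    omega
  have h' := congrArg (Nat.cast : ℕ → ℂ) h
  push_cast at h'
  linear_combination h'

/-- Clearing the denominator `2k+1` shows that the coefficients of `P_m` are integers, and that
the formula remains correct for `k > m`. -/
lemma coeff_genP (m k : ℕ) :
    (genP m).coeff k = (m + k).choose (2 * k) + 2 * (m + k).choose (2 * k + 1) := by
  have hk : (2 * (k : ℂ) + 1) ≠ 0 := by exact_mod_cast Nat.succ_ne_zero (2 * k)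
  simp only [genP, finsetSum_coeff, coeff_C_mul_X_pow]
  rw [Finset.sum_ite_eq]
  split_ifs with h
  · have hkm : k ≤ m := by simpa [Nat.lt_succ_iff] using h
    have h1 := congrArg (Nat.cast : ℕ → ℂ) (Nat.choose_succ_right_eq (m + k) (2 * k))
    have h2 : m + k - 2 * k = m - k := by omega
    rw [h2] at h1
    push_cast [Nat.cast_sub hkm] at h1
    field_simp
    linear_combination (-2) * h1
  · have hkm : m < k := by simpa [Nat.lt_succ_iff] using h
    rw [Nat.choose_eq_zero_of_lt (by omega), Nat.choose_eq_zero_of_lt (by omega)]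
    simp

/-- The analogue of `coeff_genP` for `Q_m`; it also covers the constant term, where the truncated
subtraction `0 + 0 - 1 = 0` gives the right value for `m = 0`. -/
lemma coeff_genQ (m k : ℕ) :
    (genQ m).coeff k = (m + k).choose (2 * k) + (m + k - 1).choose (2 * k) := by
  simp only [genQ, coeff_add, finsetSum_coeff, coeff_C_mul_X_pow]
  rw [Finset.sum_ite_eq, coeff_C]
  rcases Nat.eq_zero_or_pos k with rfl | hk
  · norm_num
  · obtain ⟨k, rfl⟩ : ∃ j, k = j + 1 := ⟨k - 1, by omega⟩
    rw [if_neg (by omega), zero_add]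
    split_ifs with h
    · have hkm : k + 1 ≤ m := (Finset.mem_Icc.1 h).2
      have h1 := congrArg (Nat.cast : ℕ → ℂ) (Nat.choose_succ_right_eq (m + k) (2 * k + 1))
      have h2 : m + k - (2 * k + 1) = m - (k + 1) := by omega
      rw [h2] at h1
      push_cast [Nat.cast_sub hkm] at h1
      have h3 : ((m + k + 1).choose (2 * k + 1 + 1) : ℂ) =
          (m + k).choose (2 * k + 1) + (m + k).choose (2 * k + 1 + 1) := by
        exact_mod_cast Nat.choose_succ_succ (m + k) (2 * k + 1)
      have h4 : m + (k + 1) = m + k + 1 := by ring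
      have h5 : 2 * (k + 1) = 2 * k + 1 + 1 := by ring
      have hk0 : ((k : ℂ) + 1) ≠ 0 := by exact_mod_cast Nat.succ_ne_zero k
      rw [h4, h5, h3]
      simp only [Nat.add_sub_cancel]
      push_cast
      field_simp
      linear_combination -h1
    · have hkm : m < k + 1 := by simpa using h
      rw [Nat.choose_eq_zero_of_lt (by omega), Nat.choose_eq_zero_of_lt (by omega)]
      simp

lemma genP_recurrence (m : ℕ) : genP (m + 2) = (X + 2) * genP (m + 1) - genP m := by
  ext k
  have hX : (X + 2) * genP (m + 1) = X * genP (m + 1) + C 2 * genP (m + 1) := by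
    rw [add_mul]; rfl
  rw [hX, coeff_sub, coeff_add, coeff_C_mul]
  rcases k with _ | k
  · simp only [coeff_X_mul_zero, coeff_genP]
    norm_num
    ring
  · rw [coeff_X_mul]
    simp only [coeff_genP]
    have h1 := choose_second_difference (m + (k + 1)) (2 * k)
    have h2 := choose_second_difference (m + (k + 1)) (2 * k + 1)
    have e1 : m + 2 + (k + 1) = m + (k + 1) + 2 := by ring
    have e2 : m + 1 + (k + 1) = m + (k + 1) + 1 := by ring
    have e3 : m + 1 + k = m + (k + 1) := by ring
    have e4 : 2 * (k + 1) = 2 * k + 2 := by ring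
    have e5 : 2 * k + 2 + 1 = 2 * k + 1 + 2 := by ring
    rw [e1, e2, e3, e4, e5, h1, h2]
    ring

lemma genQ_recurrence (m : ℕ) : genQ (m + 2) = (X + 2) * genQ (m + 1) - genQ m := by
  ext k
  have hX : (X + 2) * genQ (m + 1) = X * genQ (m + 1) + C 2 * genQ (m + 1) := by
    rw [add_mul]; rfl
  rw [hX, coeff_sub, coeff_add, coeff_C_mul]
  rcases k with _ | k
  · simp only [coeff_X_mul_zero, coeff_genQ]
    norm_num
  · rw [coeff_X_mul]
    simp only [coeff_genQ]
    have h1 := choose_second_difference (m + (k + 1)) (2 * k)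
    have h2 := choose_second_difference (m + k) (2 * k)
    have e1 : m + 2 + (k + 1) = m + (k + 1) + 2 := by ring
    have e2 : m + 1 + (k + 1) = m + (k + 1) + 1 := by ring
    have e3 : m + 1 + k = m + (k + 1) := by ring
    have e4 : 2 * (k + 1) = 2 * k + 2 := by ring
    have e6 : m + (k + 1) + 2 - 1 = m + k + 2 := by omega
    have e7 : m + (k + 1) + 1 - 1 = m + k + 1 := by omega
    have e8 : m + (k + 1) - 1 = m + k := by omega
    rw [e1, e2, e3, e4, e6, e7, e8, h1, h2]
    ring

lemma genP_zero : genP 0 = 1 := by simp [genP]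

lemma genP_one : genP 1 = X + 3 := by
  ext k
  rcases k with _ | _ | k
  · simp [coeff_genP]; norm_num
  · simp [coeff_genP, coeff_X]
  · rw [coeff_genP, Nat.choose_eq_zero_of_lt (by omega), Nat.choose_eq_zero_of_lt (by omega)]
    simp [coeff_X]

lemma genQ_zero : genQ 0 = 2 := by
  simp only [genQ, Finset.Icc_eq_empty_of_lt zero_lt_one, Finset.sum_empty, add_zero]
  rfl

lemma genQ_one : genQ 1 = X + 2 := by
  simp only [genQ, Finset.Icc_self, Finset.sum_singleton]
  norm_num
  exact add_comm _ _

/-! ### Closed forms and iterated recurrences -/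

lemma eval_genP_sub_two (m : ℕ) {x a b w : ℂ} (hx : x ≠ 2) (ha : a ^ 2 = x + 2)
    (hb : b ^ 2 = x - 2) (hw : w = a * b) :
    (genP m).eval (x - 2) =
      (1 / 2 ^ (m + 1)) * ((1 - a / b) * (x - w) ^ m + (1 + a / b) * (x + w) ^ m) := by
  have hb0 : b ≠ 0 := by
    rintro rfl
    exact hx (by linear_combination -hb)
  have hw2 : w ^ 2 = x ^ 2 - 4 := by
    rw [hw, mul_pow, ha, hb]; ring
  induction m using Nat.twoStepInduction with
  | zero => simp [genP_zero]; ring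
  | one =>
    simp only [genP_one, eval_add, eval_X, eval_ofNat, hw]
    field_simp
    linear_combination (-2 * b) * ha
  | more m h1 h2 =>
    simp only [genP_recurrence, eval_sub, eval_mul, eval_add, eval_X, eval_ofNat, h1, h2]
    -- `x ± w` are the roots of `u ^ 2 = 2 * x * u - 4`
    -- so that `((x ± w) / 2) ^ m` solves the recurrence
    have e1 : (x - w) ^ (m + 2) = (x - w) ^ m * (2 * x * (x - w) - 4) := by
      rw [pow_add]; linear_combination (x - w) ^ m * hw2
    have e2 : (x + w) ^ (m + 2) = (x + w) ^ m * (2 * x * (x + w) - 4) := by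
      rw [pow_add]; linear_combination (x + w) ^ m * hw2
    rw [e1, e2]
    simp only [pow_succ]
    field_simp
    ring

lemma eval_genQ_sub_two (m : ℕ) {x w : ℂ} (hw : w ^ 2 = x ^ 2 - 4) :
    (genQ m).eval (x - 2) = (1 / 2 ^ m) * ((x - w) ^ m + (x + w) ^ m) := by
  induction m using Nat.twoStepInduction with
  | zero => simp [genQ_zero]; norm_num
  | one => simp [genQ_one]; ring
  | more m h1 h2 =>
    simp only [genQ_recurrence, eval_sub, eval_mul, eval_add, eval_X, eval_ofNat, h1, h2]
    -- `x ± w` are the roots of `u ^ 2 = 2 * x * u - 4`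
    -- so that `((x ± w) / 2) ^ m` solves the recurrence
    have e1 : (x - w) ^ (m + 2) = (x - w) ^ m * (2 * x * (x - w) - 4) := by
      rw [pow_add]; linear_combination (x - w) ^ m * hw
    have e2 : (x + w) ^ (m + 2) = (x + w) ^ m * (2 * x * (x + w) - 4) := by
      rw [pow_add]; linear_combination (x + w) ^ m * hw
    rw [e1, e2]
    simp only [pow_succ]
    field_simp
    ring

/-- Iterating a recurrence `u (n + 2) = y * u (n + 1) - u n`: with the shift operator `E` this is
the binomial expansion of `E ^ (2 * r) = (y * E - 1) ^ r`. -/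
lemma iterate_recurrence {u : ℕ → ℂ} {y : ℂ} (hu : ∀ n, u (n + 2) = y * u (n + 1) - u n)
    (r n : ℕ) :
    u (n + 2 * r) =
      ∑ j ∈ Finset.range (r + 1),
        (r.choose j : ℂ) * ((-1) ^ j * y ^ (r - j) * u (n + (r - j))) := by
  induction r generalizing n with
  | zero => simp
  | succ r ih =>
    rw [Finset.sum_choose_succ_mul (fun j i => (-1) ^ j * y ^ i * u (n + i)) r,
      ← Finset.sum_add_distrib, show n + 2 * (r + 1) = n + 2 + 2 * r by ring, ih (n + 2)]
    refine Finset.sum_congr rfl fun j hj => ?_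
    have hj' : j ≤ r := Nat.lt_succ_iff.1 (Finset.mem_range.1 hj)
    rw [show n + 2 + (r - j) = n + (r - j) + 2 by ring, hu, Nat.succ_sub hj', Nat.succ_eq_add_one,
      ← add_assoc n]
    ring

lemma iterate_recurrence_of_le {u : ℕ → ℂ} {y : ℂ} (hu : ∀ n, u (n + 2) = y * u (n + 1) - u n)
    {m r : ℕ} (h : r ≤ m / 2) :
    u m = ∑ j ∈ Finset.range (r + 1),
      (-1) ^ j * (r.choose j : ℂ) * y ^ (r - j) * u (m - r - j) := by
  have hm : m = m - 2 * r + 2 * r := by omega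
  conv_lhs => rw [hm, iterate_recurrence hu]
  refine Finset.sum_congr rfl fun j hj => ?_
  have hj' : j ≤ r := Nat.lt_succ_iff.1 (Finset.mem_range.1 hj)
  rw [show m - 2 * r + (r - j) = m - r - j by omega]
  ring

/-- The derivative identity `X(X+4) c_n' = (n+ε)(2c_{n+1} - (X+2)c_n) - ε(X+4)c_n` propagates along
the Chebyshev recurrence. In the variable `X + 2 = 2 cos θ` it is the formula for `(1-x²) T_n'`
when `ε = 0`, and its analogue for `sin ((n + 1/2) θ) / sin (θ / 2)` when `ε = 1/2`. -/
lemma derivative_of_recurrence {c : ℕ → ℂ[X]} {ε : ℂ}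
    (hc : ∀ n, c (n + 2) = (X + 2) * c (n + 1) - c n)
    (h0 : X * (X + 4) * derivative (c 0) =
      C ε * (2 * c 1 - (X + 2) * c 0) - C ε * (X + 4) * c 0)
    (h1 : X * (X + 4) * derivative (c 1) =
      (1 + C ε) * (2 * c 2 - (X + 2) * c 1) - C ε * (X + 4) * c 1) (n : ℕ) :
    X * (X + 4) * derivative (c n) =
      ((n : ℂ[X]) + C ε) * (2 * c (n + 1) - (X + 2) * c n) - C ε * (X + 4) * c n := by
  induction n using Nat.twoStepInduction with
  | zero => simpa using h0
  | one => simpa using h1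
  | more n ih0 ih1 =>
    have hd : derivative (c (n + 2)) =
        c (n + 1) + (X + 2) * derivative (c (n + 1)) - derivative (c n) := by
      rw [hc]; simp
    have hn : c (n + 2 + 1) = (X + 2) * c (n + 2) - c (n + 1) := hc (n + 1)
    rw [hd, hn, hc]
    rw [show n + 1 + 1 = n + 2 from rfl, hc] at ih1
    push_cast at ih1 ⊢
    linear_combination (X + 2) * ih1 - ih0

lemma derivative_genP (n : ℕ) :
    X * (X + 4) * derivative (genP n) =
      ((n : ℂ[X]) + C (1 / 2)) * (2 * genP (n + 1) - (X + 2) * genP n)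
        - C (1 / 2) * (X + 4) * genP n := by
  have h : (C (1 / 2 : ℂ)) * 2 = 1 := by
    rw [show (2 : ℂ[X]) = C 2 from rfl, ← C_mul]; norm_num
  refine derivative_of_recurrence genP_recurrence ?_ ?_ n
  · rw [genP_zero, genP_one]; simp only [derivative_one]; ring
  · rw [genP_recurrence 0, genP_zero, genP_one]
    simp only [derivative_add, derivative_X, derivative_ofNat]
    linear_combination (X + 4) * h

lemma derivative_genQ (n : ℕ) :
    X * (X + 4) * derivative (genQ n) =
      ((n : ℂ[X]) + C 0) * (2 * genQ (n + 1) - (X + 2) * genQ n) - C 0 * (X + 4) * genQ n := by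
  refine derivative_of_recurrence genQ_recurrence ?_ ?_ n
  · rw [genQ_zero, genQ_one]; simp
  · rw [genQ_recurrence 0, genQ_zero, genQ_one]
    simp only [derivative_add, derivative_X, derivative_ofNat, C_0]
    ring

/-! ### The beta functional -/

/-- The linear functional `p ↦ ∫₀¹ p(-4t) t^(a-1) (1-t)^(b-1) dt`, given by its moments
`X^k ↦ (-4)^k B(a+k, b)`. -/
noncomputable def betaFunctional (a b : ℂ) : ℂ[X] →ₗ[ℂ] ℂ :=
  lsum fun k => ((-4) ^ k * Complex.betaIntegral (a + k) b) • LinearMap.id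

lemma betaFunctional_monomial (a b r : ℂ) (k : ℕ) :
    betaFunctional a b (monomial k r) = (-4) ^ k * Complex.betaIntegral (a + k) b * r := by
  simp [betaFunctional, lsum_apply, sum_monomial_index]

lemma betaFunctional_one (a b : ℂ) : betaFunctional a b 1 = Complex.betaIntegral a b := by
  simpa using betaFunctional_monomial a b 1 0

lemma betaFunctional_C_mul (a b r : ℂ) (p : ℂ[X]) :
    betaFunctional a b (C r * p) = r * betaFunctional a b p := by
  rw [← smul_eq_C_mul, map_smul, smul_eq_mul]

lemma betaFunctional_two_mul (a b : ℂ) (p : ℂ[X]) :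
    betaFunctional a b (2 * p) = 2 * betaFunctional a b p :=
  betaFunctional_C_mul a b 2 p

lemma betaIntegral_succ_left {a b : ℂ} (ha : 0 < a.re) (hb : 0 < b.re) :
    (a + b) * Complex.betaIntegral (a + 1) b = a * Complex.betaIntegral a b := by
  have hab : 0 < (a + b).re := by rw [Complex.add_re]; exact add_pos ha hb
  have h1 := Complex.Gamma_mul_Gamma_eq_betaIntegral ha hb
  have ha1 : 0 < (a + 1).re := by
    rw [Complex.add_re, Complex.one_re]; exact add_pos ha one_pos
  have h2 := Complex.Gamma_mul_Gamma_eq_betaIntegral ha1 hb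
  have ha0 : a ≠ 0 := fun h => by simp [h] at ha
  have hab0 : a + b ≠ 0 := fun h => by simp [h] at hab
  rw [add_right_comm, Complex.Gamma_add_one _ ha0, Complex.Gamma_add_one _ hab0] at h2
  have hG := Complex.Gamma_ne_zero_of_re_pos hab
  refine mul_left_cancel₀ hG ?_
  linear_combination a * h1 - h2

/-- Integration by parts against the beta weight: the integral of
`d/dt (t^a (1-t)^b F(-4t))` vanishes. -/
lemma betaFunctional_by_parts {a b : ℂ} (ha : 0 < a.re) (hb : 0 < b.re) (F : ℂ[X]) :
    betaFunctional a b ((C (4 * a) + C (a + b) * X) * F + X * (X + 4) * derivative F) = 0 := by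
  induction F using Polynomial.induction_on' with
  | add p q hp hq =>
    have e : (C (4 * a) + C (a + b) * X) * (p + q) + X * (X + 4) * derivative (p + q) =
        ((C (4 * a) + C (a + b) * X) * p + X * (X + 4) * derivative p) +
          ((C (4 * a) + C (a + b) * X) * q + X * (X + 4) * derivative q) := by
      rw [derivative_add]; ring
    rw [e, LinearMap.map_add, hp, hq, add_zero]
  | monomial k r =>
    have hd : X * derivative (monomial k r) = C (k : ℂ) * monomial k r := by
      rcases k with _ | k
      · simp
      · rw [derivative_monomial, X_mul_monomial, C_mul_monomial, Nat.add_sub_cancel, mul_comm]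
    have h : (C (4 * a) + C (a + b) * X) * monomial k r + X * (X + 4) * derivative (monomial k r) =
        C (4 * (a + k)) * monomial k r + C (a + b + k) * monomial (k + 1) r := by
      rw [← X_mul_monomial]
      simp only [C_mul, C_add]
      rw [show (C 4 : ℂ[X]) = 4 from rfl]
      linear_combination (X + 4) * hd
    have hak : 0 < (a + k).re := by
      simp only [Complex.add_re, Complex.natCast_re]
      positivity
    have hB := betaIntegral_succ_left hak hb
    rw [h, map_add, betaFunctional_C_mul, betaFunctional_C_mul, betaFunctional_monomial,
      betaFunctional_monomial, pow_succ, Nat.cast_succ, ← add_assoc]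
    linear_combination (-4) * (-4) ^ k * r * hB

lemma betaFunctional_X {a b : ℂ} (ha : 0 < a.re) (hb : 0 < b.re) :
    (a + b) * betaFunctional a b X = -4 * a * Complex.betaIntegral a b := by
  have h := betaFunctional_by_parts ha hb 1
  rw [derivative_one, mul_zero, add_zero, add_mul, mul_one (_ * X), LinearMap.map_add,
    betaFunctional_C_mul, betaFunctional_C_mul, betaFunctional_one] at h
  linear_combination h

lemma betaFunctional_genP_one {a b : ℂ} (ha : 0 < a.re) (hb : 0 < b.re) :
    (a + b) * betaFunctional a b (genP 1) = (3 * b - a) * Complex.betaIntegral a b := by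
  have h := betaFunctional_X ha hb
  rw [genP_one, map_add, ← mul_one (3 : ℂ[X]), show (3 : ℂ[X]) = C 3 from rfl,
    betaFunctional_C_mul, betaFunctional_one]
  linear_combination h

lemma betaFunctional_genQ_zero (a b : ℂ) :
    betaFunctional a b (genQ 0) = 2 * Complex.betaIntegral a b := by
  rw [genQ_zero, ← mul_one (2 : ℂ[X]), betaFunctional_two_mul, betaFunctional_one]

lemma betaFunctional_genQ_one {a b : ℂ} (ha : 0 < a.re) (hb : 0 < b.re) :
    (a + b) * betaFunctional a b (genQ 1) = 2 * (b - a) * Complex.betaIntegral a b := by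
  have h := betaFunctional_X ha hb
  rw [genQ_one, map_add, ← mul_one (2 : ℂ[X]), betaFunctional_two_mul, betaFunctional_one]
  linear_combination h

/-- Integration by parts turns the derivative identity into a three-term recurrence for the
values of the beta functional, with no shift of the exponents `a` and `b`. -/
lemma betaFunctional_recurrence {c : ℕ → ℂ[X]} {ε : ℂ}
    (hc : ∀ n, c (n + 2) = (X + 2) * c (n + 1) - c n)
    (hd : ∀ n : ℕ, X * (X + 4) * derivative (c n) =
      ((n : ℂ[X]) + C ε) * (2 * c (n + 1) - (X + 2) * c n) - C ε * (X + 4) * c n)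
    {a b : ℂ} (ha : 0 < a.re) (hb : 0 < b.re) (n : ℕ) :
    (a + b + n + 1) * betaFunctional a b (c (n + 2)) =
      2 * (b - a + ε) * betaFunctional a b (c (n + 1)) +
        (n + 1 + 2 * ε - a - b) * betaFunctional a b (c n) := by
  have h := betaFunctional_by_parts ha hb (c (n + 1))
  have e : (C (4 * a) + C (a + b) * X) * c (n + 1) + X * (X + 4) * derivative (c (n + 1)) =
      C (a + b + n + 1) * c (n + 2) - C (2 * (b - a + ε)) * c (n + 1) -
        C (n + 1 + 2 * ε - a - b) * c n := by
    rw [hd, hc]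
    simp only [C_mul, C_add, C_sub, C_1, map_natCast]
    rw [show (C 4 : ℂ[X]) = 4 from rfl, show (C 2 : ℂ[X]) = 2 from rfl]
    push_cast
    ring
  rw [e] at h
  simp only [LinearMap.map_sub, betaFunctional_C_mul] at h
  linear_combination h

/-! ### Orthogonality -/

/-- A solution of the Chebyshev recurrence whose members of positive index are annihilated by
the beta functional is orthogonal to all polynomials of smaller degree, since multiplication
by `X` changes the index by at most one. -/
lemma betaFunctional_mul_eq_zero {c : ℕ → ℂ[X]}
    (hc : ∀ n, c (n + 2) = (X + 2) * c (n + 1) - c n) {a b : ℂ}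
    (h : ∀ n, betaFunctional a b (c (n + 1)) = 0) {k : ℕ} {f : ℂ[X]} (hf : f.degree < k) :
    betaFunctional a b (c k * f) = 0 := by
  have hX : ∀ j k : ℕ, betaFunctional a b (c (k + j + 1) * X ^ j) = 0 := by
    intro j
    induction j with
    | zero => intro k; simpa using h k
    | succ j ih =>
      intro k
      have e : c (k + (j + 1) + 1) * X ^ (j + 1) =
          c (k + 2 + j + 1) * X ^ j - 2 * (c (k + 1 + j + 1) * X ^ j) + c (k + j + 1) * X ^ j := by
        rw [show k + 2 + j + 1 = k + j + 1 + 2 by ring, hc,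
          show k + (j + 1) + 1 = k + j + 1 + 1 by ring, show k + 1 + j + 1 = k + j + 1 + 1 by ring]
        ring
      rw [e, map_add, map_sub, betaFunctional_two_mul, ih, ih, ih]
      ring
  rw [f.as_sum_range_C_mul_X_pow, Finset.mul_sum, map_sum]
  refine Finset.sum_eq_zero fun j hj => ?_
  rcases eq_or_ne f 0 with rfl | hf0
  · simp
  · have hjk : j < k := by
      rw [degree_eq_natDegree hf0, Nat.cast_lt] at hf
      have := Finset.mem_range.1 hj
      omega
    obtain ⟨i, rfl⟩ : ∃ i, k = i + j + 1 := ⟨k - j - 1, by omega⟩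
    rw [mul_left_comm, betaFunctional_C_mul, hX, mul_zero]

lemma betaFunctional_genP_succ (n : ℕ) : betaFunctional (3 / 2) (1 / 2) (genP (n + 1)) = 0 := by
  have ha : 0 < (3 / 2 : ℂ).re := by norm_num
  have hb : 0 < (1 / 2 : ℂ).re := by norm_num
  induction n using Nat.twoStepInduction with
  | zero =>
    have h := betaFunctional_genP_one ha hb
    norm_num at h
    exact h
  | one =>
    have h := betaFunctional_recurrence genP_recurrence derivative_genP ha hb 0
    have h1 := betaFunctional_genP_one ha hb
    norm_num at h h1
    rw [h1] at h
    simpa using h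
  | more n ih0 ih1 =>
    have h := betaFunctional_recurrence genP_recurrence derivative_genP ha hb (n + 1)
    rw [ih0, show n + 1 + 1 = n + 2 from rfl, ih1] at h
    simp only [mul_zero, add_zero, mul_eq_zero] at h
    refine h.resolve_left fun h0 => ?_
    have := congrArg Complex.re h0
    norm_num at this
    linarith [(Nat.cast_nonneg n : (0 : ℝ) ≤ n)]

lemma betaFunctional_genQ_succ (n : ℕ) : betaFunctional (1 / 2) (1 / 2) (genQ (n + 1)) = 0 := by
  have hb : 0 < (1 / 2 : ℂ).re := by norm_num
  induction n using Nat.twoStepInduction with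
  | zero =>
    have h := betaFunctional_genQ_one hb hb
    norm_num at h
    exact h
  | one =>
    have h := betaFunctional_recurrence genQ_recurrence derivative_genQ hb hb 0
    have h1 := betaFunctional_genQ_one hb hb
    norm_num at h h1
    exact h
  | more n ih0 ih1 =>
    have h := betaFunctional_recurrence genQ_recurrence derivative_genQ hb hb (n + 1)
    rw [ih0, show n + 1 + 1 = n + 2 from rfl, ih1] at h
    simp only [mul_zero, add_zero, mul_eq_zero] at h
    refine h.resolve_left fun h0 => ?_
    have := congrArg Complex.re h0
    norm_num at this
    linarith [(Nat.cast_nonneg n : (0 : ℝ) ≤ n)]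

/-! ### A family of polynomials with zeros on the critical line -/

/-- The polynomials given by `A₀ = 1`, `A₁ = -σ` and `A_{n+2} = -2σ A_{n+1} + ((n+δ)² - σ²) A_n`,
where `σ = s - 1/2`. The Mellin transforms of `P_n` and `Q_n` lead to `δ = 1` and `δ = 1/2`. -/
noncomputable def critPoly (δ : ℝ) : ℕ → ℂ[X]
  | 0 => 1
  | 1 => -(X - C (1 / 2))
  | n + 2 => -2 * (X - C (1 / 2)) * critPoly δ (n + 1) +
      (C (((n + δ : ℝ) : ℂ) ^ 2) - (X - C (1 / 2)) ^ 2) * critPoly δ n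

lemma eval_critPoly_zero (δ : ℝ) (s : ℂ) : (critPoly δ 0).eval s = 1 := by simp [critPoly]

lemma eval_critPoly_one (δ : ℝ) (s : ℂ) : (critPoly δ 1).eval s = -(s - 1 / 2) := by
  simp [critPoly]

lemma eval_critPoly_add_two (δ : ℝ) (n : ℕ) (s : ℂ) :
    (critPoly δ (n + 2)).eval s = -2 * (s - 1 / 2) * (critPoly δ (n + 1)).eval s +
      (((n + δ : ℝ) : ℂ) ^ 2 - (s - 1 / 2) ^ 2) * (critPoly δ n).eval s := by
  simp [critPoly]

lemma eval_critPoly_one_sub (δ : ℝ) (n : ℕ) (s : ℂ) :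
    (critPoly δ n).eval (1 - s) = (-1) ^ n * (critPoly δ n).eval s := by
  induction n using Nat.twoStepInduction with
  | zero => simp [eval_critPoly_zero]
  | one => rw [eval_critPoly_one, eval_critPoly_one]; ring
  | more n h0 h1 =>
    rw [eval_critPoly_add_two, eval_critPoly_add_two, h0, h1]
    ring

/-- The Möbius maps `g ↦ (σ g + r²) / (g + σ)`, with `r` real and `Re σ > 0`, preserve the right
half-plane. -/
lemma re_mobius_nonneg {σ g : ℂ} (r : ℝ) (hσ : 0 < σ.re) (hg : 0 ≤ g.re) :
    0 ≤ ((σ * g + (r : ℂ) ^ 2) / (g + σ)).re := by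
  rw [Complex.div_re, ← add_div]
  refine div_nonneg ?_ (Complex.normSq_nonneg _)
  have e : (σ * g + (r : ℂ) ^ 2).re * (g + σ).re + (σ * g + (r : ℂ) ^ 2).im * (g + σ).im =
      g.re * (σ.re ^ 2 + σ.im ^ 2) + σ.re * (g.re ^ 2 + g.im ^ 2) + r ^ 2 * (g.re + σ.re) := by
    simp only [← Complex.ofReal_pow, Complex.add_re, Complex.add_im, Complex.mul_re,
      Complex.mul_im, Complex.ofReal_re, Complex.ofReal_im]
    ring
  rw [e]
  positivity

/-- To the right of the critical line the ratio `-A_{n+1} / A_n` has the form `g + σ` with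
`Re g ≥ 0`: the recurrence acts on `g` by a Möbius map preserving the right half-plane. In
particular no `A_n` vanishes there. -/
lemma exists_ratio_critPoly (δ : ℝ) {s : ℂ} (hs : 1 / 2 < s.re) (n : ℕ) :
    (critPoly δ n).eval s ≠ 0 ∧ ∃ g : ℂ, 0 ≤ g.re ∧
      (critPoly δ (n + 1)).eval s = -(g + (s - 1 / 2)) * (critPoly δ n).eval s := by
  have hσ : 0 < (s - 1 / 2).re := by
    have : (s - 1 / 2).re = s.re - 1 / 2 := by norm_num
    linarith
  induction n with
  | zero =>
    refine ⟨by simp [eval_critPoly_zero], 0, le_rfl, ?_⟩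
    rw [zero_add, eval_critPoly_one, eval_critPoly_zero]; ring
  | succ n ih =>
    obtain ⟨h0, g, hg, h⟩ := ih
    have hne : g + (s - 1 / 2) ≠ 0 := fun h' => by
      have := congrArg Complex.re h'
      rw [Complex.add_re, Complex.zero_re] at this
      linarith
    refine ⟨?_, _, re_mobius_nonneg (n + δ) hσ hg, ?_⟩
    · rw [h]
      exact mul_ne_zero (neg_ne_zero.2 hne) h0
    · rw [eval_critPoly_add_two, h]
      generalize s - 1 / 2 = σ at hne
      push_cast
      field_simp
      ring

lemma re_eq_half_of_eval_critPoly_eq_zero {δ : ℝ} {n : ℕ} {s : ℂ}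
    (h : (critPoly δ n).eval s = 0) : s.re = 1 / 2 := by
  rcases lt_trichotomy s.re (1 / 2) with hs | hs | hs
  · have h' : 1 / 2 < (1 - s).re := by rw [Complex.sub_re, Complex.one_re]; linarith
    refine absurd ?_ (exists_ratio_critPoly δ h' n).1
    rw [eval_critPoly_one_sub, h, mul_zero]
  · exact hs
  · exact absurd h (exists_ratio_critPoly δ hs n).1

lemma hasCriticalSymmetry_C_mul_critPoly {r : ℂ} (hr : r ≠ 0) (δ : ℝ) (n : ℕ) :
    HasCriticalSymmetry (C r * critPoly δ n) := by
  refine ⟨?_, fun s hs => ?_⟩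
  · rcases neg_one_pow_eq_or ℂ n with h | h
    · left
      intro s
      rw [eval_mul, eval_mul, eval_critPoly_one_sub, h, eval_C, eval_C, one_mul]
    · right
      intro s
      rw [eval_mul, eval_mul, eval_critPoly_one_sub, h, eval_C, eval_C]
      ring
  · rw [eval_mul, eval_C] at hs
    exact re_eq_half_of_eval_critPoly_eq_zero ((mul_eq_zero.1 hs).resolve_left hr)

/-! ### Evaluation of the beta functional -/

lemma add_natCast_ne_zero {z : ℂ} (hz : 0 < z.re) (n : ℕ) : z + n ≠ 0 := by
  intro h
  have := congrArg Complex.re h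
  simp only [Complex.add_re, Complex.natCast_re, Complex.zero_re] at this
  linarith [(Nat.cast_nonneg n : (0 : ℝ) ≤ n)]

lemma Gamma_add_natCast_succ {z : ℂ} (hz : 0 < z.re) (n : ℕ) :
    Complex.Gamma (z + (n + 1 : ℕ)) = (z + n) * Complex.Gamma (z + n) := by
  rw [Nat.cast_succ, ← add_assoc, Complex.Gamma_add_one _ (add_natCast_ne_zero hz n)]

/-- Multiplied by `Γ(z + n)`, the solution of the recurrence for the beta functional satisfies the
recurrence of `critPoly`. -/
lemma mul_Gamma_eq_critPoly {I : ℕ → ℂ} {z s K : ℂ} {δ : ℝ} (hz : 0 < z.re)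
    (hδ : z = s - 1 / 2 + δ)
    (h0 : I 0 * Complex.Gamma z = K)
    (h1 : z * I 1 = -(s - 1 / 2) * I 0)
    (hI : ∀ n : ℕ, (z + n + 1) * I (n + 2) =
      -2 * (s - 1 / 2) * I (n + 1) + (n + 2 * δ - z) * I n) (n : ℕ) :
    I n * Complex.Gamma (z + n) = K * (critPoly δ n).eval s := by
  induction n using Nat.twoStepInduction with
  | zero => simpa [eval_critPoly_zero] using h0
  | one =>
    have hG := Gamma_add_natCast_succ hz 0
    simp only [zero_add, Nat.cast_zero, add_zero] at hG
    rw [hG, eval_critPoly_one]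
    linear_combination Complex.Gamma z * h1 - (s - 1 / 2) * h0
  | more n ih0 ih1 =>
    have hG1 := Gamma_add_natCast_succ hz n
    have hG2 := Gamma_add_natCast_succ hz (n + 1)
    rw [show n + 1 + 1 = n + 2 from rfl] at hG2
    rw [hG1] at ih1
    rw [hG2, hG1, eval_critPoly_add_two]
    have h := hI n
    push_cast
    subst hδ
    linear_combination
      (s - 1 / 2 + δ + n) * Complex.Gamma (s - 1 / 2 + δ + n) * h - 2 * (s - 1 / 2) * ih1 +
        ((n + δ) ^ 2 - (s - 1 / 2) ^ 2) * ih0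

/-- The value of the Mellin transform of `P_n`, up to the explicit powers of `-1` and `4`. -/
lemma betaFunctional_genP {s : ℂ} (hs : -1 / 4 < s.re) (n : ℕ) :
    betaFunctional (s + 1 / 4) (1 / 4) (genP n) * Complex.Gamma (s + (2 * n + 1) / 2) =
      Complex.Gamma (s + 1 / 4) * Complex.Gamma (1 / 4) * (critPoly 1 n).eval s := by
  have ha : 0 < (s + 1 / 4).re := by
    have : (s + 1 / 4).re = s.re + 1 / 4 := by norm_num
    linarith
  have hb : 0 < (1 / 4 : ℂ).re := by norm_num
  have hz : 0 < (s + 1 / 2).re := by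
    have : (s + 1 / 2).re = s.re + 1 / 2 := by norm_num
    linarith
  have hB := Complex.Gamma_mul_Gamma_eq_betaIntegral ha hb
  have hab : s + 1 / 4 + 1 / 4 = s + 1 / 2 := by ring
  rw [hab] at hB
  rw [show s + (2 * n + 1) / 2 = s + 1 / 2 + n by ring]
  refine mul_Gamma_eq_critPoly (I := fun n => betaFunctional (s + 1 / 4) (1 / 4) (genP n))
    hz (by push_cast; ring) ?_ ?_ (fun n => ?_) n
  · simp only [genP_zero, betaFunctional_one]
    rw [hB, mul_comm]
  · have h := betaFunctional_genP_one ha hb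
    simp only [genP_zero, betaFunctional_one]
    linear_combination h
  · have h := betaFunctional_recurrence genP_recurrence derivative_genP ha hb n
    push_cast
    linear_combination h

/-- The value of the Mellin transform of `Q_n`, up to the explicit powers of `-1` and `4`. -/
lemma betaFunctional_genQ {s : ℂ} (hs : 1 / 4 < s.re) (n : ℕ) :
    betaFunctional (s - 1 / 4) (1 / 4) (genQ n) * Complex.Gamma (s + n) =
      2 * (Complex.Gamma (s - 1 / 4) * Complex.Gamma (1 / 4)) * (critPoly (1 / 2) n).eval s := by
  have ha : 0 < (s - 1 / 4).re := by
    have : (s - 1 / 4).re = s.re - 1 / 4 := by norm_num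
    linarith
  have hb : 0 < (1 / 4 : ℂ).re := by norm_num
  have hz : 0 < s.re := by linarith
  have hB := Complex.Gamma_mul_Gamma_eq_betaIntegral ha hb
  rw [sub_add_cancel] at hB
  refine mul_Gamma_eq_critPoly (I := fun n => betaFunctional (s - 1 / 4) (1 / 4) (genQ n))
    hz (by push_cast; ring) ?_ ?_ (fun n => ?_) n
  · simp only [betaFunctional_genQ_zero]
    linear_combination (-2) * hB
  · have h := betaFunctional_genQ_one ha hb
    simp only [betaFunctional_genQ_zero]
    linear_combination h
  · have h := betaFunctional_recurrence genQ_recurrence derivative_genQ ha hb n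
    push_cast
    linear_combination h

/-! ### Beta integrals over `(-4, 0)` -/

lemma neg_one_cpow (y : ℂ) : (-1 : ℂ) ^ y = Complex.exp (Real.pi * Complex.I * y) := by
  rw [Complex.cpow_def_of_ne_zero (by norm_num), Complex.log_neg_one]

/-- Principal powers of negative reals split off the principal power of `-1`. -/
lemma ofReal_neg_cpow {x : ℝ} (hx : 0 ≤ x) (y : ℂ) :
    ((-x : ℝ) : ℂ) ^ y = (-1) ^ y * (x : ℂ) ^ y := by
  rw [Complex.ofReal_cpow_of_nonpos (neg_nonpos.2 hx), neg_one_cpow, mul_comm, Complex.ofReal_neg,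
    neg_neg]

/-- The substitution `x = -4t` reduces the claim to the integrand of the beta integral. -/
lemma betaIntegrand_intervalIntegrable {a b : ℂ} (ha : 0 < a.re) (hb : 0 < b.re) :
    IntervalIntegrable (fun x : ℝ => (x : ℂ) ^ (a - 1) * ((4 + x : ℝ) : ℂ) ^ (b - 1))
      MeasureTheory.volume (-4) 0 := by
  have h1 := (Complex.betaIntegral_convergent ha hb).comp_mul_left (c := -1 / 4)
  norm_num at h1
  have h2 := (h1.const_mul ((-1 : ℂ) ^ (a - 1) * 4 ^ (a - 1) * 4 ^ (b - 1))).symm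
  refine h2.congr fun x hx => ?_
  rw [Set.uIoc_of_le (by norm_num)] at hx
  have hx0 : 0 ≤ -x := by linarith [hx.2]
  have hx4 : 0 ≤ 4 + x := by linarith [hx.1]
  have e1 : (x : ℂ) ^ (a - 1) =
      (-1) ^ (a - 1) * (4 ^ (a - 1) * (-((1 / 4 : ℂ) * x)) ^ (a - 1)) := by
    have h := Complex.mul_cpow_ofReal_nonneg (a := 4) (b := -x / 4) (by norm_num) (by linarith)
      (a - 1)
    have h' := ofReal_neg_cpow hx0 (a - 1)
    rw [neg_neg] at h'
    push_cast at h h'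
    rw [h', show -((1 / 4 : ℂ) * x) = -x / 4 by ring, ← h]
    congr 2
    ring
  have e2 : ((4 + x : ℝ) : ℂ) ^ (b - 1) = 4 ^ (b - 1) * (1 + (1 / 4 : ℂ) * x) ^ (b - 1) := by
    have h := Complex.mul_cpow_ofReal_nonneg (a := 4) (b := (4 + x) / 4) (by norm_num)
      (by linarith) (b - 1)
    push_cast at h
    rw [show (1 + (1 / 4 : ℂ) * x) = (4 + x) / 4 by ring, ← h]
    push_cast
    congr 1
    ring
  simp only [e1, e2]
  ring

lemma intervalIntegrable_eval_mul_betaIntegrand {a b : ℂ} (ha : 0 < a.re) (hb : 0 < b.re)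
    (p : ℂ[X]) :
    IntervalIntegrable
      (fun x : ℝ => p.eval (x : ℂ) * ((x : ℂ) ^ (a - 1) * ((4 + x : ℝ) : ℂ) ^ (b - 1)))
      MeasureTheory.volume (-4) 0 :=
  (betaIntegrand_intervalIntegrable ha hb).continuousOn_mul
    (p.continuous.comp Complex.continuous_ofReal).continuousOn

lemma integral_betaIntegrand (a b : ℂ) :
    ∫ x in (-4 : ℝ)..0, (x : ℂ) ^ (a - 1) * ((4 + x : ℝ) : ℂ) ^ (b - 1) =
      (-1) ^ (a - 1) * 4 ^ (a + b - 1) * Complex.betaIntegral a b := by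
  have h := Complex.betaIntegral_scaled a b (a := 4) (by norm_num)
  rw [Complex.ofReal_ofNat] at h
  rw [mul_assoc, ← h, ← intervalIntegral.integral_const_mul]
  have h0 := intervalIntegral.integral_comp_neg (a := 0) (b := 4)
    (fun x : ℝ => (x : ℂ) ^ (a - 1) * ((4 + x : ℝ) : ℂ) ^ (b - 1))
  rw [neg_zero] at h0
  rw [← h0]
  refine intervalIntegral.integral_congr fun x hx => ?_
  rw [Set.uIcc_of_le (by norm_num)] at hx
  simp only [ofReal_neg_cpow hx.1]
  push_cast
  rw [← sub_eq_add_neg, mul_assoc]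

/-- The beta functional is, up to an explicit factor, integration over `(-4, 0)` against the
weight `x^(a-1) (4+x)^(b-1)`. -/
lemma integral_eval_mul_betaIntegrand {a b : ℂ} (ha : 0 < a.re) (hb : 0 < b.re) (p : ℂ[X]) :
    ∫ x in (-4 : ℝ)..0, p.eval (x : ℂ) * ((x : ℂ) ^ (a - 1) * ((4 + x : ℝ) : ℂ) ^ (b - 1)) =
      (-1) ^ (a - 1) * 4 ^ (a + b - 1) * betaFunctional a b p := by
  induction p using Polynomial.induction_on' with
  | add p q hp hq =>
    rw [LinearMap.map_add, mul_add, ← hp, ← hq, ← intervalIntegral.integral_add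
      (intervalIntegrable_eval_mul_betaIntegrand ha hb p)
      (intervalIntegrable_eval_mul_betaIntegrand ha hb q)]
    simp only [eval_add, add_mul]
  | monomial k r =>
    rw [betaFunctional_monomial]
    have h := integral_betaIntegrand (a + k) b
    have e1 : (-1 : ℂ) ^ (a + k - 1) = (-1) ^ (a - 1) * (-1) ^ k := by
      rw [show a + k - 1 = a - 1 + k by ring, Complex.cpow_add _ _ (by norm_num),
        Complex.cpow_natCast]
    have e2 : (4 : ℂ) ^ (a + k + b - 1) = 4 ^ (a + b - 1) * 4 ^ k := by
      rw [show a + k + b - 1 = a + b - 1 + k by ring, Complex.cpow_add _ _ (by norm_num),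
        Complex.cpow_natCast]
    have e3 : (-4 : ℂ) ^ k = (-1) ^ k * 4 ^ k := by
      rw [← mul_pow]; norm_num
    rw [e1, e2] at h
    rw [e3, show (-1 : ℂ) ^ (a - 1) * 4 ^ (a + b - 1) *
        ((-1) ^ k * 4 ^ k * Complex.betaIntegral (a + k) b * r) =
      r * ((-1 : ℂ) ^ (a - 1) * (-1) ^ k * (4 ^ (a + b - 1) * 4 ^ k) *
        Complex.betaIntegral (a + k) b) by ring, ← h,
      ← intervalIntegral.integral_const_mul]
    refine intervalIntegral.integral_congr_ae ?_
    -- at `x = 0` the two sides may differ, because of the value of `0 ^ 0`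
    have h0 : ∀ᵐ x : ℝ, x ≠ 0 := by
      simp [MeasureTheory.ae_iff]
    filter_upwards [h0] with x hx _
    have hx' : (x : ℂ) ≠ 0 := Complex.ofReal_ne_zero.2 hx
    rw [eval_monomial, show a + k - 1 = a - 1 + k by ring, Complex.cpow_add _ _ hx',
      Complex.cpow_natCast]
    ring

/-! ### Orthogonality and Mellin integrals -/

lemma orthoIntegrandP_eq (k : ℕ) (f : ℂ[X]) :
    orthoIntegrandP k f = fun x : ℝ => (genP k * f).eval (x : ℂ) *
      ((x : ℂ) ^ (3 / 2 - 1 : ℂ) * ((4 + x : ℝ) : ℂ) ^ (1 / 2 - 1 : ℂ)) := by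
  funext x
  rw [orthoIntegrandP, eval_mul]
  norm_num
  ring

lemma orthoIntegrandQ_eq (k : ℕ) (f : ℂ[X]) :
    orthoIntegrandQ k f = fun x : ℝ => (genQ k * f).eval (x : ℂ) *
      ((x : ℂ) ^ (1 / 2 - 1 : ℂ) * ((4 + x : ℝ) : ℂ) ^ (1 / 2 - 1 : ℂ)) := by
  funext x
  rw [orthoIntegrandQ, eval_mul]
  norm_num
  ring

lemma mellinIntegrandP_eq (n : ℕ) (s : ℂ) :
    mellinIntegrandP n s = fun x : ℝ => (genP n).eval (x : ℂ) *
      ((x : ℂ) ^ (s + 1 / 4 - 1) * ((4 + x : ℝ) : ℂ) ^ (1 / 4 - 1 : ℂ)) := by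
  funext x
  rw [mellinIntegrandP, show (1 / 4 - 1 : ℂ) = -(3 / 4) by norm_num, Complex.cpow_neg,
    show s + 1 / 4 - 1 = s - 3 / 4 by ring, div_eq_mul_inv, mul_assoc]

lemma mellinIntegrandQ_eq (n : ℕ) (s : ℂ) :
    mellinIntegrandQ n s = fun x : ℝ => (genQ n).eval (x : ℂ) *
      ((x : ℂ) ^ (s - 1 / 4 - 1) * ((4 + x : ℝ) : ℂ) ^ (1 / 4 - 1 : ℂ)) := by
  funext x
  rw [mellinIntegrandQ, show (1 / 4 - 1 : ℂ) = -(3 / 4) by norm_num, Complex.cpow_neg,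
    show s - 1 / 4 - 1 = s - 5 / 4 by ring, div_eq_mul_inv, mul_assoc]

lemma neg_one_cpow_add_two (y : ℂ) : (-1 : ℂ) ^ (y + 2) = (-1) ^ y := by
  rw [Complex.cpow_add _ _ (by norm_num), show (2 : ℂ) = ((2 : ℕ) : ℂ) by norm_num,
    Complex.cpow_natCast]
  norm_num

/-- The factor `2 * 4 ^ n` is the quotient of `4 ^ (s - 1 / 2)`, from the beta integral, by
`4 ^ s * 4 ^ (-n - 1)`. -/
lemma isMellinFactorP_critPoly (n : ℕ) : IsMellinFactorP n (C (2 * 4 ^ n) * critPoly 1 n) := by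
  intro s hs
  have ha : 0 < (s + 1 / 4).re := by
    have : (s + 1 / 4).re = s.re + 1 / 4 := by norm_num
    linarith
  have hz : Complex.Gamma (s + (2 * n + 1) / 2) ≠ 0 := by
    refine Complex.Gamma_ne_zero_of_re_pos ?_
    have : (s + (2 * n + 1) / 2).re = s.re + (2 * n + 1) / 2 := by
      rw [show (s + (2 * n + 1) / 2) = s + (((2 * n + 1) / 2 : ℝ) : ℂ) by push_cast; ring,
        Complex.add_re, Complex.ofReal_re]
    rw [this]
    linarith [(Nat.cast_nonneg n : (0 : ℝ) ≤ n)]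
  have h2 : (4 : ℂ) ^ (-1 / 2 : ℂ) = 1 / 2 := by
    rw [show (4 : ℂ) = ((2 : ℝ) : ℂ) * ((2 : ℝ) : ℂ) by norm_num,
      Complex.mul_cpow_ofReal_nonneg zero_le_two zero_le_two, ← Complex.cpow_add _ _ (by norm_num)]
    norm_num [Complex.cpow_neg_one]
  have h4 : (4 : ℂ) ^ (-(n : ℂ) - 1) = 1 / (4 * 4 ^ n) := by
    rw [show -(n : ℂ) - 1 = -((n + 1 : ℕ) : ℂ) by push_cast; ring, Complex.cpow_neg,
      Complex.cpow_natCast, pow_succ, mul_comm, one_div]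
  have hL := betaFunctional_genP hs n
  rw [mellinP, mellinIntegrandP_eq, integral_eval_mul_betaIntegrand ha (by norm_num), eval_mul,
    eval_C, h4, show s + 5 / 4 = s + 1 / 4 - 1 + 2 by ring, neg_one_cpow_add_two,
    show s + 1 / 4 + 1 / 4 - 1 = s + -1 / 2 by ring, Complex.cpow_add _ _ (by norm_num), h2,
    eq_div_of_mul_eq hz hL]
  field_simp
  ring

/-- Of the factor `8`, a factor `2` is the value of `Q_0` and `4 = Γ(1/4) / Γ(5/4)`. -/
lemma isMellinFactorQ_critPoly (n : ℕ) : IsMellinFactorQ n (C 8 * critPoly (1 / 2) n) := by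
  intro s hs
  have ha : 0 < (s - 1 / 4).re := by
    have : (s - 1 / 4).re = s.re - 1 / 4 := by norm_num
    linarith
  have hz : Complex.Gamma (s + n) ≠ 0 := by
    refine Complex.Gamma_ne_zero_of_re_pos ?_
    rw [Complex.add_re, Complex.natCast_re]
    linarith [(Nat.cast_nonneg n : (0 : ℝ) ≤ n)]
  have hG : Complex.Gamma (5 / 4) = 1 / 4 * Complex.Gamma (1 / 4) := by
    rw [← Complex.Gamma_add_one _ (by norm_num)]
    norm_num
  have hL := betaFunctional_genQ hs n
  rw [mellinQ, mellinIntegrandQ_eq, integral_eval_mul_betaIntegrand ha (by norm_num), eval_mul,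
    eval_C, hG, show s + 3 / 4 = s - 1 / 4 - 1 + 2 by ring, neg_one_cpow_add_two,
    show s - 1 / 4 + 1 / 4 - 1 = s - 1 by ring, eq_div_of_mul_eq hz hL]
  ring

lemma eq_of_eval_eq_of_one_lt {p q : ℂ[X]}
    (h : ∀ t : ℝ, 1 < t → p.eval (t : ℂ) = q.eval (t : ℂ)) : p = q := by
  refine eq_of_infinite_eval_eq p q (Set.Infinite.mono ?_
    ((Set.Ioi_infinite (1 : ℝ)).image Complex.ofReal_injective.injOn))
  rintro _ ⟨t, ht, rfl⟩
  exact h t ht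

lemma IsMellinFactorP.unique {n : ℕ} {p q : ℂ[X]} (hp : IsMellinFactorP n p)
    (hq : IsMellinFactorP n q) : p = q := by
  refine eq_of_eval_eq_of_one_lt fun t ht => ?_
  have hre : -1 / 4 < (t : ℂ).re := by rw [Complex.ofReal_re]; linarith
  have h := (hp t hre).symm.trans (hq t hre)
  have h1 : Complex.Gamma (t + 1 / 4) ≠ 0 := by
    refine Complex.Gamma_ne_zero_of_re_pos ?_
    rw [show (t + 1 / 4 : ℂ) = ((t + 1 / 4 : ℝ) : ℂ) by push_cast; ring, Complex.ofReal_re]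
    linarith
  have h2 : Complex.Gamma (t + (2 * n + 1) / 2) ≠ 0 := by
    refine Complex.Gamma_ne_zero_of_re_pos ?_
    rw [show (t + (2 * n + 1) / 2 : ℂ) = ((t + (2 * n + 1) / 2 : ℝ) : ℂ) by push_cast; ring,
      Complex.ofReal_re]
    positivity
  have h3 : Complex.Gamma (1 / 4) ≠ 0 := Complex.Gamma_ne_zero_of_re_pos (by norm_num)
  have h4 : ∀ y : ℂ, (4 : ℂ) ^ y ≠ 0 := fun y => by simp [Complex.cpow_eq_zero_iff]
  have h5 : ∀ y : ℂ, (-1 : ℂ) ^ y ≠ 0 := fun y => by simp [Complex.cpow_eq_zero_iff]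
  have h6 := mul_right_cancel₀ (div_ne_zero h1 h2) h
  exact mul_left_cancel₀ (mul_ne_zero (mul_ne_zero (mul_ne_zero (h5 _) (h4 _)) (h4 _)) h3) h6

lemma IsMellinFactorQ.unique {n : ℕ} {p q : ℂ[X]} (hp : IsMellinFactorQ n p)
    (hq : IsMellinFactorQ n q) : p = q := by
  refine eq_of_eval_eq_of_one_lt fun t ht => ?_
  have hre : 1 / 4 < (t : ℂ).re := by rw [Complex.ofReal_re]; linarith
  have h := (hp t hre).symm.trans (hq t hre)
  have h1 : Complex.Gamma (t - 1 / 4) ≠ 0 := by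
    refine Complex.Gamma_ne_zero_of_re_pos ?_
    rw [show (t - 1 / 4 : ℂ) = ((t - 1 / 4 : ℝ) : ℂ) by push_cast; ring, Complex.ofReal_re]
    linarith
  have h2 : Complex.Gamma (t + n) ≠ 0 := by
    refine Complex.Gamma_ne_zero_of_re_pos ?_
    rw [Complex.add_re, Complex.natCast_re, Complex.ofReal_re]
    positivity
  have h3 : Complex.Gamma (5 / 4) ≠ 0 := Complex.Gamma_ne_zero_of_re_pos (by norm_num)
  have h4 : ∀ y : ℂ, (4 : ℂ) ^ y ≠ 0 := fun y => by simp [Complex.cpow_eq_zero_iff]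
  have h5 : ∀ y : ℂ, (-1 : ℂ) ^ y ≠ 0 := fun y => by simp [Complex.cpow_eq_zero_iff]
  have h6 := mul_right_cancel₀ (div_ne_zero h1 h2) h
  exact mul_left_cancel₀ (mul_ne_zero (mul_ne_zero (h5 _) (h4 _)) h3) h6

theorem mainTheorem9 :
    -- closed form of `P_m(x-2)`: `a = √(x+2)`, `b = √(x-2)`, `w = √(x²-4) = a * b`
    (∀ (m : ℕ) (x a b w : ℂ), x ≠ 2 → a ^ 2 = x + 2 → b ^ 2 = x - 2 → w = a * b →
      (genP m).eval (x - 2) =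
        (1 / 2 ^ (m + 1)) * ((1 - a / b) * (x - w) ^ m + (1 + a / b) * (x + w) ^ m)) ∧
    -- closed form of `Q_m(x-2)`: `w = √(x²-4)`
    (∀ (m : ℕ) (x w : ℂ), w ^ 2 = x ^ 2 - 4 →
      (genQ m).eval (x - 2) = (1 / 2 ^ m) * ((x - w) ^ m + (x + w) ^ m)) ∧
    -- iterated recurrences
    (∀ (m r : ℕ) (x : ℂ), r ≤ m / 2 →
      (genP m).eval x = ∑ j ∈ Finset.range (r + 1),
        (-1) ^ j * (r.choose j : ℂ) * (x + 2) ^ (r - j) * (genP (m - r - j)).eval x) ∧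
    (∀ (m r : ℕ) (x : ℂ), r ≤ m / 2 →
      (genQ m).eval x = ∑ j ∈ Finset.range (r + 1),
        (-1) ^ j * (r.choose j : ℂ) * (x + 2) ^ (r - j) * (genQ (m - r - j)).eval x) ∧
    -- orthogonality to all polynomials of smaller degree
    (∀ (k : ℕ) (f : Polynomial ℂ), f.degree < k →
      IntervalIntegrable (orthoIntegrandP k f) MeasureTheory.volume (-4) 0 ∧
        ∫ x in (-4 : ℝ)..0, orthoIntegrandP k f x = 0) ∧
    (∀ (k : ℕ) (f : Polynomial ℂ), f.degree < k →
      IntervalIntegrable (orthoIntegrandQ k f) MeasureTheory.volume (-4) 0 ∧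
        ∫ x in (-4 : ℝ)..0, orthoIntegrandQ k f x = 0) ∧
    -- the Mellin transforms converge and have a unique polynomial factor,
    -- with functional equation and zeros only on the critical line
    (∀ (n : ℕ) (s : ℂ), -1 / 4 < s.re →
      IntervalIntegrable (mellinIntegrandP n s) MeasureTheory.volume (-4) 0) ∧
    (∀ (n : ℕ) (s : ℂ), 1 / 4 < s.re →
      IntervalIntegrable (mellinIntegrandQ n s) MeasureTheory.volume (-4) 0) ∧
    (∀ n : ℕ, (∃! p : Polynomial ℂ, IsMellinFactorP n p) ∧
      ∀ p : Polynomial ℂ, IsMellinFactorP n p → HasCriticalSymmetry p) ∧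
    (∀ n : ℕ, (∃! q : Polynomial ℂ, IsMellinFactorQ n q) ∧
      ∀ q : Polynomial ℂ, IsMellinFactorQ n q → HasCriticalSymmetry q) := by
  refine ⟨fun m x a b w hx ha hb hw => eval_genP_sub_two m hx ha hb hw,
    fun m x w hw => eval_genQ_sub_two m hw,
    fun m r x h => iterate_recurrence_of_le (u := fun n => (genP n).eval x) (fun n => ?_) h,
    fun m r x h => iterate_recurrence_of_le (u := fun n => (genQ n).eval x) (fun n => ?_) h,
    fun k f hf => ?_, fun k f hf => ?_, fun n s hs => ?_, fun n s hs => ?_,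
    fun n => ⟨⟨_, isMellinFactorP_critPoly n, fun p hp => hp.unique (isMellinFactorP_critPoly n)⟩,
      fun p hp => ?_⟩,
    fun n => ⟨⟨_, isMellinFactorQ_critPoly n, fun q hq => hq.unique (isMellinFactorQ_critPoly n)⟩,
      fun q hq => ?_⟩⟩
  · simp [genP_recurrence]
  · simp [genQ_recurrence]
  · rw [orthoIntegrandP_eq]
    refine ⟨intervalIntegrable_eval_mul_betaIntegrand (by norm_num) (by norm_num) _, ?_⟩
    rw [integral_eval_mul_betaIntegrand (by norm_num) (by norm_num),
      betaFunctional_mul_eq_zero genP_recurrence betaFunctional_genP_succ hf, mul_zero]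
  · rw [orthoIntegrandQ_eq]
    refine ⟨intervalIntegrable_eval_mul_betaIntegrand (by norm_num) (by norm_num) _, ?_⟩
    rw [integral_eval_mul_betaIntegrand (by norm_num) (by norm_num),
      betaFunctional_mul_eq_zero genQ_recurrence betaFunctional_genQ_succ hf, mul_zero]
  · rw [mellinIntegrandP_eq]
    refine intervalIntegrable_eval_mul_betaIntegrand ?_ (by norm_num) _
    have : (s + 1 / 4).re = s.re + 1 / 4 := by norm_num
    linarith
  · rw [mellinIntegrandQ_eq]
    refine intervalIntegrable_eval_mul_betaIntegrand ?_ (by norm_num) _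
    have : (s - 1 / 4).re = s.re - 1 / 4 := by norm_num
    linarith
  · rw [hp.unique (isMellinFactorP_critPoly n)]
    exact hasCriticalSymmetry_C_mul_critPoly
      (mul_ne_zero two_ne_zero (pow_ne_zero n (by norm_num))) 1 n
  · rw [hq.unique (isMellinFactorQ_critPoly n)]
    exact hasCriticalSymmetry_C_mul_critPoly (by norm_num) (1 / 2) n
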